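/- Let $L=C_2\wr\mathbb Z=\{(n,A): n\in\mathbb Z,\ A\subseteq\mathbb Z \text{ finite}\}$ be the lamplighter group, with product $(n,A)(m,B)=(n+m,\,A\triangle(n+B))$ and identity $e=(0,\emptyset)$, let $D=\{(-1,\emptyset),(1,\emptyset),(1,\{0\}),(-1,\{-1\})\}$ be the Diestel--Leader generators, and let $G=\operatorname{Cay}(L,D)$ be the Cayley graph with vertex set $L$ and edges $(x,x\gamma)$, $\gamma\in D$ (edges are ordered pairs of adjacent vertices). Let $\operatorname{Aut}(G)$ act on labellings of the vertices or edges of $G$ by $(f\cdot\ell)(x)=\ell(f^{-1}(x))$, respectively $(f\cdot \ell)(x,y)=\ell(f^{-1}(x),f^{-1}(y))$, and let $L$ act through left translations. Let $\operatorname{Aut}_e(G)$ be the stabilizer of $e$ in $\operatorname{Aut}(G)$. A Cayley diagram on $G$ is a labelling $d$ of the edges of $G$ by elements of $D$ such that, at every vertex, each element of $D$ is the label of exactly one outgoing edge, and such that for every walk $(x_0,\dots,x_k)$ in $G$ one has $d(x_0,x_1)\cdots d(x_{k-1},x_k)=e$ if and only if $x_0=x_k$. A Borel probability measure $\mu$ on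 $D$-valued edge labellings is $\operatorname{Aut}(G)$-f.i.i.d. if it is the push-forward of $\lambda^L$ ($\lambda$ Lebesgue measure on $[0,1]$) under a measurable map $F$ defined on $[0,1]^L$ such that for every $f\in\operatorname{Aut}(G)$ one has $F(f\cdot x)=f\cdot F(x)$ for $\lambda^L$-almost every $x$. Then: 1. The elements $f\in\operatorname{Aut}_e(G)$ that preserve the quasi-order $(n,A)\le(m,B)\Leftrightarrow n\le m$ (that is, $x\le y\Leftrightarrow f(x)\le f(y)$) form a subgroup of index $2$ in $\operatorname{Aut}_e(G)$. 2. No $\operatorname{Aut}(G)$-invariant Borel probability measure on edge labellings that is carried by the Cayley diagrams on $G$ is ergodic under $L$: for every such $\mu$ there is an $L$-invariant measurable set $S$ of edge labellings with $0<\mu(S)<1$. 3. $G$ admits no $\operatorname{Aut}(G)$-f.i.i.d. Cayley diagram: there is no $\operatorname{Aut}(G)$-f.i.i.d. measure $\mu$ on edge labellings such that $\mu$-almost every labelling is a Cayley diagram. -/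

import Mathlib

open MeasureTheory

namespace FIIDCayley

/-! ### Labellings of a graph and the action of its automorphism group -/

section Labellings

/-- The action of `Aut(G)` on vertex labellings, `(f · x)(v) = x (f⁻¹ v)`. -/
def shiftVertex {V A : Type*} {G : SimpleGraph V} (f : G ≃g G) (x : V → A) : V → A :=
  fun v => x (f.symm v)

/-- The action of `Aut(G)` on edge labellings, `(f · d)(v, w) = d (f⁻¹ v, f⁻¹ w)`.
A dart is an ordered pair of adjacent vertices. -/
def shiftEdge {V A : Type*} {G : SimpleGraph V} (f : G ≃g G) (d : G.Dart → A) : G.Dart → A :=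
  fun e => d (f.symm.toHom.mapDart e)

/-- The measure `λ^V` on `[0,1]^V`: independent uniform labels at the vertices. -/
noncomputable def iidMeasure (V : Type*) : Measure (V → unitInterval) :=
  Measure.infinitePi fun _ => volume

/-- A measure on edge labellings of `G` is `Aut(G)`-f.i.i.d. if it is a factor of
`([0,1]^V, λ^V)`, i.e. the push-forward of `λ^V` under a measurable map that commutes almost
everywhere with every automorphism of `G`. -/
def IsAutFIID {V A : Type*} [MeasurableSpace A] (G : SimpleGraph V)
    (μ : Measure (G.Dart → A)) : Prop :=
  ∃ F : (V → unitInterval) → (G.Dart → A), Measurable F ∧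
    (∀ f : G ≃g G, ∀ᵐ x ∂(iidMeasure V), F (shiftVertex f x) = shiftEdge f (F x)) ∧
    Measure.map F (iidMeasure V) = μ

end Labellings

/-! ### Cayley diagrams -/

section CayleyDiagrams

/-- `d` is a Cayley diagram for the marked group `(Γ, E)` (with `E` symmetric and `1 ∉ E`) on the
graph `H`, whose components are copies of `Cay(Γ, E)`: at each vertex every
generator labels exactly one outgoing edge, and the product of the labels along a walk is trivial
if and only if the walk is closed. -/
structure IsCayleyDiagram {Γ V : Type*} [Group Γ] (E : Set Γ) (H : SimpleGraph V)
    (d : H.Dart → E) : Prop where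
  atMostOne : ∀ e e' : H.Dart, e.fst = e'.fst → d e = d e' → e = e'
  atLeastOne : ∀ (x : V) (γ : E), ∃ e : H.Dart, e.fst = x ∧ d e = γ
  closed_iff : ∀ (x y : V) (p : H.Walk x y),
    (p.darts.map fun e => (d e : Γ)).prod = 1 ↔ x = y

/-- `G = Cay(Γ, E)`, with edges `(x, xγ)` for `γ ∈ E`, admits an `Aut(G)`-f.i.i.d. Cayley
diagram: some `Aut(G)`-f.i.i.d. measure on edge labellings is carried by the Cayley diagrams. -/
def AdmitsAutFIIDCayleyDiagram {Γ : Type*} [Group Γ] [MeasurableSpace Γ] (E : Set Γ) : Prop :=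
  ∃ μ : Measure ((SimpleGraph.mulCayley E).Dart → E),
    IsAutFIID (SimpleGraph.mulCayley E) μ ∧
      ∀ᵐ d ∂μ, IsCayleyDiagram E (SimpleGraph.mulCayley E) d

/-- Left translation by `γ`, as an automorphism of `Cay(Γ, E)`. -/
def translation {Γ : Type*} [Group Γ] (E : Set Γ) (γ : Γ) :
    SimpleGraph.mulCayley E ≃g SimpleGraph.mulCayley E where
  toEquiv := Equiv.mulLeft γ
  map_rel_iff' := by
    intro a b
    simp [SimpleGraph.mulCayley_adj', mul_assoc]

/-- `Aut_e(G)`: the automorphisms of `G = Cay(Γ, E)` that fix the identity of `Γ`. -/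
def rotations {Γ : Type*} [Group Γ] (E : Set Γ) :
    Subgroup (SimpleGraph.mulCayley E ≃g SimpleGraph.mulCayley E) :=
  MulAction.stabilizer _ (1 : Γ)

end CayleyDiagrams

/-! ### The lamplighter group -/

/-- Elements `(n, A)` of the lamplighter group `C₂ ≀ ℤ`: an integer `n` and a finite set `A` of
integers. -/
@[ext]
structure Lamplighter where
  pos : ℤ
  lamps : Finset ℤ

namespace Lamplighter

/-- `(n, A) * (m, B) = (n + m, A ∆ (n + B))`. -/
instance : Mul Lamplighter :=
  ⟨fun x y => ⟨x.pos + y.pos, symmDiff x.lamps (y.lamps.map (addLeftEmbedding x.pos))⟩⟩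

instance : One Lamplighter := ⟨⟨0, ∅⟩⟩

/-- `(n, A)⁻¹ = (-n, -n + A)`. -/
instance : Inv Lamplighter := ⟨fun x => ⟨-x.pos, x.lamps.map (addLeftEmbedding (-x.pos))⟩⟩

theorem pos_mul (x y : Lamplighter) : (x * y).pos = x.pos + y.pos := rfl

theorem lamps_mul (x y : Lamplighter) :
    (x * y).lamps = symmDiff x.lamps (y.lamps.map (addLeftEmbedding x.pos)) := rfl

theorem pos_one : (1 : Lamplighter).pos = 0 := rfl

theorem lamps_one : (1 : Lamplighter).lamps = ∅ := rfl

theorem pos_inv (x : Lamplighter) : (x⁻¹).pos = -x.pos := rfl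

theorem lamps_inv (x : Lamplighter) :
    (x⁻¹).lamps = x.lamps.map (addLeftEmbedding (-x.pos)) := rfl

theorem mem_map_add (n k : ℤ) (A : Finset ℤ) :
    k ∈ A.map (addLeftEmbedding n) ↔ k - n ∈ A := by
  simp only [Finset.mem_map, addLeftEmbedding_apply]
  constructor
  · rintro ⟨a, ha, rfl⟩
    simpa using ha
  · intro h
    exact ⟨k - n, h, by ring⟩

instance : Group Lamplighter :=
  Group.ofLeftAxioms
    (by
      intro x y z
      ext k
      · simp only [pos_mul, add_assoc]
      · simp only [lamps_mul, pos_mul, Finset.mem_symmDiff, mem_map_add, sub_sub]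
        tauto)
    (by
      intro x
      ext k
      · simp only [pos_mul, pos_one, zero_add]
      · simp [lamps_mul, pos_one, lamps_one, Finset.mem_symmDiff])
    (by
      intro x
      ext k
      · simp only [pos_mul, pos_inv, pos_one, neg_add_cancel]
      · simp [lamps_mul, pos_inv, lamps_inv, lamps_one])

/-- The lamplighter group is a discrete (countable) group: every subset is measurable. -/
instance : MeasurableSpace Lamplighter := ⊤

/-- The Diestel–Leader generators. -/
def diestelLeader : Set Lamplighter :=
  {⟨-1, ∅⟩, ⟨1, ∅⟩, ⟨1, {0}⟩, ⟨-1, {-1}⟩}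

/-- The Cayley graph of the lamplighter group with the Diestel–Leader generators. -/
abbrev graph : SimpleGraph Lamplighter := SimpleGraph.mulCayley diestelLeader

/-- The automorphisms of the Cayley graph that preserve the quasi-order
`(n, A) ≤ (m, B) ↔ n ≤ m`. -/
def orderPreserving : Subgroup (graph ≃g graph) where
  carrier := {f | ∀ x y : Lamplighter, (f x).pos ≤ (f y).pos ↔ x.pos ≤ y.pos}
  mul_mem' := by
    intro f g hf hg x y
    exact (hf (g x) (g y)).trans (hg x y)
  one_mem' := fun _ _ => Iff.rfl
  inv_mem' := by
    intro f hf x y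
    have h := hf (f⁻¹ x) (f⁻¹ y)
    rw [RelIso.apply_inv_self, RelIso.apply_inv_self] at h
    exact h.symm

end Lamplighter

end FIIDCayley

namespace FIIDCayley

open Set ProbabilityTheory
open scoped symmDiff

/-! ### The Bernoulli measure on labellings -/

section Bernoulli

/-! Every Cayley diagram on this graph determines a global sign: its labels either all follow the
change of level along their edges or all reverse it (`mem_signed_of_isCayleyDiagram`). Two
generators that move the position the same way differ by an involution, so in any diagram the edges
they label at a vertex extend to a 4-cycle. In a 4-cycle of the graph, vertices opposite each other
lie on one level (`pos_eq_of_common_neighbors`), and each vertex has only two neighbours on each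
side, which gives a sign at the vertex. Connectedness makes it global.

Translations preserve the sign and `reflection` reverses it. An invariant measure on diagrams
therefore gives each sign mass 1/2, and the `L`-invariant event `signed 1` refutes ergodicity. A
factor of the Bernoulli measure is ergodic under translations, so none is carried by diagrams.

The index claim uses the same dichotomy: an automorphism carries the standard diagram to another
diagram, so it has a sign, and the order-preserving ones are those of sign 1. -/

instance isProbabilityMeasure_iidMeasure (V : Type*) : IsProbabilityMeasure (iidMeasure V) := by
  unfold iidMeasure; infer_instance

theorem measurable_shiftVertex {V A : Type*} [MeasurableSpace A] {G : SimpleGraph V}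
    (f : G ≃g G) : Measurable (shiftVertex f : (V → A) → V → A) :=
  measurable_pi_lambda _ fun _ => measurable_pi_apply _

theorem measurable_shiftEdge {V A : Type*} [MeasurableSpace A] {G : SimpleGraph V}
    (f : G ≃g G) : Measurable (shiftEdge f : (G.Dart → A) → G.Dart → A) :=
  measurable_pi_lambda _ fun _ => measurable_pi_apply _

theorem measurePreserving_shiftVertex {V : Type*} {G : SimpleGraph V} (f : G ≃g G) :
    MeasurePreserving (shiftVertex f) (iidMeasure V) (iidMeasure V) :=
  ⟨measurable_shiftVertex f, Measure.map_infinitePi_infinitePi_of_inj f.symm.injective⟩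

/-- Events determined by disjoint finite sets of coordinates are independent. -/
theorem iidMeasure_cylinder_inter {V : Type*} {s t : Finset V} (hst : Disjoint s t)
    {A : Set (s → unitInterval)} {B : Set (t → unitInterval)} (hA : MeasurableSet A)
    (hB : MeasurableSet B) :
    iidMeasure V (cylinder s A ∩ cylinder t B) =
      iidMeasure V (cylinder s A) * iidMeasure V (cylinder t B) := by
  have h : iIndepFun (fun (v : V) (x : V → unitInterval) => x v) (iidMeasure V) :=
    iIndepFun_infinitePi (X := fun _ a => a) fun _ => measurable_id
  exact (h.indepFun_finset s t hst fun v => measurable_pi_apply v).measure_inter_preimage_eq_mul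
    _ _ hA hB

/-- If the automorphisms of `G` move every finite set of vertices off itself, then an event that
is almost surely invariant under all of them is trivial. -/
theorem iidMeasure_eq_zero_or_one {V : Type*} {G : SimpleGraph V} (K : Set (G ≃g G))
    (hK : ∀ s : Finset V, ∃ f ∈ K, ∀ v ∈ s, f v ∉ s)
    {T : Set (V → unitInterval)} (hT : MeasurableSet T)
    (hinv : ∀ f ∈ K, shiftVertex f ⁻¹' T =ᵐ[iidMeasure V] T) :
    iidMeasure V T = 0 ∨ iidMeasure V T = 1 := by
  classical
  set m := iidMeasure V with hm
  set t := m.real T with ht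
  -- Approximate `T` by a cylinder `C` up to `ε` and shift `C` off its own coordinates. By
  -- independence the intersection has measure `m.real C ^ 2`, while invariance makes it nearly `t`.
  -- Each of the two comparisons, with `t` and with `t ^ 2`, costs `2 * ε`.
  have key : ∀ ε : ℝ, 0 < ε → |t - t ^ 2| ≤ 4 * ε := by
    intro ε hε
    have hring : IsSetRing (measurableCylinders fun _ : V => unitInterval) :=
      { empty_mem := empty_mem_measurableCylinders _
        union_mem := fun _ _ h h' => union_mem_measurableCylinders h h'
        sdiff_mem := fun _ _ h h' => sdiff_mem_measurableCylinders h h' }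
    obtain ⟨C, hC, hCT⟩ := exists_measure_symmDiff_lt_of_generateFrom_isSetRing (μ := m) hring
      ⟨{univ}, countable_singleton _, singleton_subset_iff.2 (univ_mem_measurableCylinders _), by simp⟩
      (generateFrom_measurableCylinders (α := fun _ : V => unitInterval)).symm hT (ENNReal.ofReal_pos.2 hε)
    have hCm : MeasurableSet C := .of_mem_measurableCylinders hC
    have hCT' : m.real (C ∆ T) ≤ ε := ENNReal.toReal_le_of_le_ofReal hε.le hCT.le
    obtain ⟨s, A, hA, rfl⟩ := (mem_measurableCylinders C).1 hC
    obtain ⟨f, hf, hfs⟩ := hK s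
    have hfm := measurePreserving_shiftVertex f
    rw [← hm] at hfm
    set C : Set (V → unitInterval) := cylinder s A
    -- the shifted cylinder depends on the coordinates in `f⁻¹ s`
    have hmul : m.real (C ∩ shiftVertex f ⁻¹' C) = m.real C ^ 2 := by
      let s' := s.image f.symm
      have hmem : ∀ v : s, f.symm v ∈ s' := fun v => Finset.mem_image_of_mem _ v.2
      let φ : (s' → unitInterval) → (s → unitInterval) := fun x v => x ⟨f.symm v, hmem v⟩
      have hφ : Measurable φ := measurable_pi_lambda _ fun _ => measurable_pi_apply _
      have hpre : shiftVertex f ⁻¹' C = cylinder s' (φ ⁻¹' A) := rfl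
      have hdisj : Disjoint s s' := by
        rw [Finset.disjoint_left]
        intro v hv hv'
        obtain ⟨w, hw, rfl⟩ := Finset.mem_image.1 hv'
        exact hfs _ hv (by simpa using hw)
      have h := iidMeasure_cylinder_inter hdisj hA (hφ hA)
      rw [← hpre, ← hm, hfm.measure_preimage hCm.nullMeasurableSet] at h
      rw [Measure.real, h, ENNReal.toReal_mul, sq, Measure.real]
    have hTf : m.real (T ∩ shiftVertex f ⁻¹' T) = t := by
      refine measureReal_congr ?_
      have := (Filter.EventuallyEq.refl _ T).inter (hinv f hf)
      rwa [inter_self] at this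
    have hfT := hfm.measurable hT
    have hfC := hfm.measurable hCm
    have h1 : |m.real (C ∩ shiftVertex f ⁻¹' C) - m.real (T ∩ shiftVertex f ⁻¹' T)| ≤ 2 * ε := by
      refine (abs_measureReal_sub_le_measureReal_symmDiff
        (hCm.inter hfC).nullMeasurableSet (hT.inter hfT).nullMeasurableSet).trans ?_
      have hsub : (C ∩ shiftVertex f ⁻¹' C) ∆ (T ∩ shiftVertex f ⁻¹' T) ⊆
          C ∆ T ∪ shiftVertex f ⁻¹' (C ∆ T) := by
        intro x
        simp only [mem_symmDiff, mem_inter_iff, mem_union, mem_preimage]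
        tauto
      calc _ ≤ m.real (C ∆ T ∪ shiftVertex f ⁻¹' (C ∆ T)) := measureReal_mono hsub
        _ ≤ m.real (C ∆ T) + m.real (shiftVertex f ⁻¹' (C ∆ T)) := measureReal_union_le _ _
        _ = m.real (C ∆ T) + m.real (C ∆ T) := by
          rw [hfm.measureReal_preimage (hCm.symmDiff hT).nullMeasurableSet]
        _ ≤ 2 * ε := by linarith
    have h2 : |m.real C - t| ≤ ε :=
      (abs_measureReal_sub_le_measureReal_symmDiff hCm.nullMeasurableSet
        hT.nullMeasurableSet).trans hCT'
    rw [hmul, hTf] at h1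
    have h3 : |m.real C ^ 2 - t ^ 2| ≤ 2 * ε := by
      have e : m.real C ^ 2 - t ^ 2 = (m.real C - t) * (m.real C + t) := by ring
      have hc1 : m.real C ≤ 1 := measureReal_le_one
      have ht1 : t ≤ 1 := measureReal_le_one
      have hc0 : 0 ≤ m.real C := measureReal_nonneg
      have ht0 : 0 ≤ t := measureReal_nonneg
      rw [e, abs_mul, abs_of_nonneg (add_nonneg hc0 ht0), mul_comm]
      exact mul_le_mul (by linarith) h2 (abs_nonneg _) (by norm_num)
    rw [abs_le] at *
    constructor <;> linarith [h1.1, h1.2, h3.1, h3.2]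
  have h0 : t - t ^ 2 = 0 := by
    refine abs_eq_zero.1 (le_antisymm (le_of_forall_pos_le_add fun ε hε => ?_) (abs_nonneg _))
    have := key (ε / 4) (by positivity)
    linarith
  have h01 : t = 0 ∨ t = 1 := by
    have : t * (1 - t) = 0 := by linarith
    rcases mul_eq_zero.1 this with h | h
    · exact .inl h
    · exact .inr (by linarith)
  rcases h01 with h | h
  · exact .inl ((measureReal_eq_zero_iff).1 h)
  · right
    rw [← ENNReal.toReal_eq_one_iff]
    exact h

/-- A factor of the Bernoulli measure is invariant under the automorphism group. -/
theorem IsAutFIID.map_shiftEdge {V A : Type*} [MeasurableSpace A] {G : SimpleGraph V}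
    {μ : Measure (G.Dart → A)} (h : IsAutFIID G μ) (f : G ≃g G) : μ.map (shiftEdge f) = μ := by
  obtain ⟨F, hF, hequiv, rfl⟩ := h
  have hf := measurePreserving_shiftVertex f
  rw [Measure.map_map (measurable_shiftEdge f) hF]
  calc _ = (iidMeasure V).map (F ∘ shiftVertex f) :=
        Measure.map_congr ((hequiv f).mono fun _ h => h.symm)
    _ = _ := by rw [← Measure.map_map hF hf.measurable, hf.map_eq]

theorem IsAutFIID.isProbabilityMeasure {V A : Type*} [MeasurableSpace A] {G : SimpleGraph V}
    {μ : Measure (G.Dart → A)} (h : IsAutFIID G μ) : IsProbabilityMeasure μ := by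
  obtain ⟨F, hF, -, rfl⟩ := h
  exact Measure.isProbabilityMeasure_map hF.aemeasurable

/-- If the automorphisms in `K` move every finite set of vertices off itself, then a factor of
the Bernoulli measure is ergodic under `K`. -/
theorem IsAutFIID.eq_zero_or_one {V A : Type*} [MeasurableSpace A] {G : SimpleGraph V}
    {μ : Measure (G.Dart → A)} (h : IsAutFIID G μ) (K : Set (G ≃g G))
    (hK : ∀ s : Finset V, ∃ f ∈ K, ∀ v ∈ s, f v ∉ s) {S : Set (G.Dart → A)}
    (hS : MeasurableSet S) (hinv : ∀ f ∈ K, shiftEdge f ⁻¹' S = S) : μ S = 0 ∨ μ S = 1 := by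
  obtain ⟨F, hF, hequiv, rfl⟩ := h
  rw [Measure.map_apply hF hS]
  refine iidMeasure_eq_zero_or_one K hK (hF hS) fun f hf => ?_
  filter_upwards [hequiv f] with x hx
  refine propext ?_
  change F (shiftVertex f x) ∈ S ↔ F x ∈ S
  rw [hx]
  conv_rhs => rw [← hinv f hf]
  rfl

end Bernoulli

namespace Lamplighter

/-! ### The Diestel–Leader graph -/

/-- `y` is obtained from `x` by moving one step up, possibly switching the lamp on the way. -/
def UpStep (x y : Lamplighter) : Prop :=
  y.pos = x.pos + 1 ∧ ∀ k, k ≠ x.pos → (k ∈ x.lamps ↔ k ∈ y.lamps)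

/-- Trades the four explicit generators for a left-invariant relation, so that adjacency can be
handled through positions and lamps alone. -/
theorem mem_diestelLeader_iff (x : Lamplighter) :
    x ∈ diestelLeader ↔ UpStep 1 x ∨ UpStep x 1 := by
  obtain ⟨n, A⟩ := x
  simp only [diestelLeader, mem_insert_iff, mem_singleton_iff, Lamplighter.ext_iff, UpStep,
    pos_one, lamps_one, Finset.notMem_empty, false_iff, iff_false, zero_add]
  constructor
  · rintro (⟨rfl, rfl⟩ | ⟨rfl, rfl⟩ | ⟨rfl, rfl⟩ | ⟨rfl, rfl⟩) <;> simp
  · rintro (⟨rfl, h⟩ | ⟨h0, h⟩)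
    · by_cases h0 : (0 : ℤ) ∈ A
      · right; right; left
        refine ⟨rfl, ?_⟩
        ext k; simp only [Finset.mem_singleton]; grind
      · right; left
        refine ⟨rfl, ?_⟩
        ext k; simp only [Finset.notMem_empty, iff_false]; grind
    · obtain rfl : n = -1 := by omega
      by_cases h0 : (-1 : ℤ) ∈ A
      · right; right; right
        refine ⟨rfl, ?_⟩
        ext k; simp only [Finset.mem_singleton]; grind
      · left
        refine ⟨rfl, ?_⟩
        ext k; simp only [Finset.notMem_empty, iff_false]; grind

theorem upStep_mul_left (g x y : Lamplighter) : UpStep (g * x) (g * y) ↔ UpStep x y := by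
  simp only [UpStep, pos_mul, lamps_mul, Finset.mem_symmDiff, mem_map_add]
  refine and_congr (by omega) ⟨fun h k hk => ?_, fun h k hk => ?_⟩
  · have := h (g.pos + k) (by omega)
    rw [add_sub_cancel_left] at this
    tauto
  · have := h (k - g.pos) (by omega)
    tauto

theorem inv_mem_diestelLeader {x : Lamplighter} (hx : x ∈ diestelLeader) :
    x⁻¹ ∈ diestelLeader := by
  rw [mem_diestelLeader_iff] at *
  rw [← upStep_mul_left x, ← upStep_mul_left x x⁻¹, mul_inv_cancel, mul_one]
  exact hx.symm

theorem upStep_irrefl {x y : Lamplighter} (h : UpStep x y) : x ≠ y := by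
  rintro rfl
  have := h.1
  omega

theorem adj_iff_mem {x y : Lamplighter} : graph.Adj x y ↔ x⁻¹ * y ∈ diestelLeader := by
  rw [SimpleGraph.mulCayley_adj]
  constructor
  · rintro ⟨-, h | h⟩
    · exact h
    · simpa using inv_mem_diestelLeader h
  · refine fun h => ⟨?_, .inl h⟩
    rintro rfl
    rw [inv_mul_cancel, mem_diestelLeader_iff] at h
    exact h.elim (fun h => upStep_irrefl h rfl) fun h => upStep_irrefl h rfl

theorem adj_iff {x y : Lamplighter} : graph.Adj x y ↔ UpStep x y ∨ UpStep y x := by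
  rw [adj_iff_mem, mem_diestelLeader_iff, ← upStep_mul_left x, ← upStep_mul_left x _ 1]
  simp

theorem pos_eq_of_adj {x y : Lamplighter} (h : graph.Adj x y) :
    y.pos = x.pos + 1 ∨ y.pos = x.pos - 1 := by
  rcases adj_iff.1 h with h | h
  · exact .inl h.1
  · have := h.1; omega

/-- Two vertices with two common neighbours are on the same level. -/
theorem pos_eq_of_common_neighbors {x z u v : Lamplighter} (hxz : x ≠ z)
    (hxu : graph.Adj x u) (hxv : graph.Adj x v) (hzu : graph.Adj z u) (hzv : graph.Adj z v) :
    u.pos = v.pos := by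
  by_contra hne
  refine hxz ?_
  rw [adj_iff] at *
  -- If `u` is above and `v` below, then `x` and `z` agree off the lamp `x.pos` through `u`, and at
  -- that lamp through `v`, since the lower steps only touch `x.pos - 1`.
  have key : ∀ {u v : Lamplighter}, UpStep x u → UpStep v x → UpStep z u → UpStep v z → x = z := by
    intro u v h1 h2 h3 h4
    have e1 := h1.1
    have e2 := h2.1
    have e3 := h3.1
    ext k
    · omega
    · by_cases hk : k = x.pos
      · rw [← h2.2 k (by omega), h4.2 k (by omega)]
      · rw [h1.2 k hk, h3.2 k (by omega)]
  rcases hxu with h1 | h1 <;> rcases hxv with h2 | h2 <;> rcases hzu with h3 | h3 <;>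
    rcases hzv with h4 | h4 <;>
    first
    | exact key h1 h2 h3 h4
    | exact key h2 h1 h4 h3
    | (exfalso; have := h1.1; have := h2.1; have := h3.1; have := h4.1; omega)

/-- On each side, a vertex has at most two neighbours. -/
theorem eq_of_adj_of_pos_eq {x u v w : Lamplighter} (hu : graph.Adj x u) (hv : graph.Adj x v)
    (hw : graph.Adj x w) (huv : u.pos = v.pos) (huw : u.pos = w.pos) :
    u = v ∨ u = w ∨ v = w := by
  have key : ∀ {l : ℤ} {y z : Lamplighter}, (∀ k, k ≠ l → (k ∈ y.lamps ↔ k ∈ z.lamps)) →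
      y.pos = z.pos → (l ∈ y.lamps ↔ l ∈ z.lamps) → y = z := by
    intro l y z h hp hl
    ext k
    · exact hp
    · by_cases hk : k = l
      · rw [hk, hl]
      · exact h k hk
  -- All neighbours on one side differ from `x` at most in a single lamp `l`, which has only two
  -- states.
  obtain ⟨l, h⟩ : ∃ l : ℤ, ∀ y : Lamplighter, graph.Adj x y → u.pos = y.pos → ∀ k, k ≠ l →
      (k ∈ x.lamps ↔ k ∈ y.lamps) := by
    rcases pos_eq_of_adj hu with h | h
    · refine ⟨x.pos, fun y hy hp => ?_⟩
      rcases adj_iff.1 hy with hy | hy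
      · exact hy.2
      · have := hy.1; omega
    · refine ⟨x.pos - 1, fun y hy hp k hk => ?_⟩
      rcases adj_iff.1 hy with hy | hy
      · have := hy.1; omega
      · exact (hy.2 k (by omega)).symm
  have hu' := h u hu rfl
  have hv' := h v hv huv
  have hw' := h w hw huw
  by_cases a : (l ∈ u.lamps ↔ l ∈ v.lamps)
  · exact .inl (key (fun k hk => (hu' k hk).symm.trans (hv' k hk)) huv a)
  by_cases b : (l ∈ u.lamps ↔ l ∈ w.lamps)
  · exact .inr (.inl (key (fun k hk => (hu' k hk).symm.trans (hw' k hk)) huw b))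
  · exact .inr (.inr (key (fun k hk => (hv' k hk).symm.trans (hw' k hk)) (huv.symm.trans huw)
      (by tauto)))

theorem closure_diestelLeader : Subgroup.closure diestelLeader = ⊤ := by
  set H := Subgroup.closure diestelLeader
  have ha : (⟨1, ∅⟩ : Lamplighter) ∈ H := Subgroup.subset_closure (by simp [diestelLeader])
  have hb : (⟨1, {0}⟩ : Lamplighter) ∈ H := Subgroup.subset_closure (by simp [diestelLeader])
  have hpos : ∀ n : ℤ, (⟨n, ∅⟩ : Lamplighter) ∈ H := by
    intro n
    induction n using Int.induction_on with
    | zero => exact H.one_mem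
    | succ n ih =>
      convert H.mul_mem ih ha using 1
      ext j
      · rfl
      · simp [lamps_mul]
    | pred n ih =>
      convert H.mul_mem ih (H.inv_mem ha) using 1
      ext j
      · rfl
      · simp [lamps_mul, lamps_inv]
  have hlamp : ∀ k : ℤ, (⟨0, {k}⟩ : Lamplighter) ∈ H := by
    intro k
    -- Walk to `k`, switch that lamp while stepping to `k + 1`, and walk back.
    convert H.mul_mem (H.mul_mem (hpos k) hb) (hpos (-k - 1)) using 1
    ext j
    · simp only [pos_mul]; ring
    · simp [lamps_mul]
  have hlamps : ∀ A : Finset ℤ, (⟨0, A⟩ : Lamplighter) ∈ H := by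
    intro A
    induction A using Finset.induction_on with
    | empty => exact H.one_mem
    | insert k A hk ih =>
      convert H.mul_mem (hlamp k) ih using 1
      ext j
      · simp [pos_mul]
      · simp only [lamps_mul, Finset.mem_symmDiff, mem_map_add, Finset.mem_insert,
          Finset.mem_singleton, sub_zero]
        grind
  rw [eq_top_iff]
  rintro ⟨n, A⟩ -
  convert H.mul_mem (hlamps A) (hpos n) using 1
  ext j
  · simp [pos_mul]
  · simp [lamps_mul, Finset.mem_symmDiff]

/-- The graph is connected: a property that passes to neighbours holds everywhere. -/
theorem induction_on_adj {P : Lamplighter → Prop} (one : P 1)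
    (adj : ∀ x y, graph.Adj x y → P x → P y) (x : Lamplighter) : P x := by
  have hx : x ∈ Subgroup.closure diestelLeader := by rw [closure_diestelLeader]; trivial
  -- An equivalence with arbitrary base point is stable under products and inverses, as closure
  -- induction requires.
  suffices ∀ y, P y ↔ P (y * x) by simpa using (this 1).1 one
  induction hx using Subgroup.closure_induction with
  | mem g hg =>
    intro y
    have h : graph.Adj y (y * g) := by rw [adj_iff_mem]; simpa using hg
    exact ⟨adj _ _ h, adj _ _ h.symm⟩
  | one => simp
  | mul g g' _ _ ih ih' => exact fun y => by rw [← mul_assoc, ← ih', ← ih]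
  | inv g _ ih => exact fun y => by rw [ih (y * g⁻¹), inv_mul_cancel_right]

/-! ### Cayley diagrams respect the levels up to a global sign -/

theorem exists_adj_label {d : graph.Dart → diestelLeader}
    (hd : IsCayleyDiagram diestelLeader graph d) (x : Lamplighter) {γ : Lamplighter}
    (hγ : γ ∈ diestelLeader) :
    ∃ (y : Lamplighter) (h : graph.Adj x y), (d ⟨(x, y), h⟩ : Lamplighter) = γ := by
  obtain ⟨⟨⟨x', y⟩, h⟩, rfl, he⟩ := hd.atLeastOne x ⟨γ, hγ⟩
  exact ⟨y, h, congrArg Subtype.val he⟩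

theorem eq_of_label_eq {d : graph.Dart → diestelLeader}
    (hd : IsCayleyDiagram diestelLeader graph d) {x u v : Lamplighter} (hu : graph.Adj x u)
    (hv : graph.Adj x v) (h : (d ⟨(x, u), hu⟩ : Lamplighter) = d ⟨(x, v), hv⟩) : u = v := by
  have := hd.atMostOne ⟨(x, u), hu⟩ ⟨(x, v), hv⟩ rfl (Subtype.ext h)
  exact congrArg (fun e => e.snd) this

theorem label_symm {d : graph.Dart → diestelLeader}
    (hd : IsCayleyDiagram diestelLeader graph d) {x u : Lamplighter} (hu : graph.Adj x u) :
    (d ⟨(u, x), hu.symm⟩ : Lamplighter) = (d ⟨(x, u), hu⟩ : Lamplighter)⁻¹ := by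
  have := (hd.closed_iff x x (.cons hu (.cons hu.symm .nil))).2 rfl
  simp only [SimpleGraph.Walk.darts_cons, SimpleGraph.Walk.darts_nil, List.map_cons,
    List.map_nil, List.prod_cons, List.prod_nil, mul_one] at this
  exact eq_inv_of_mul_eq_one_right this

/-- Two edges whose labels `p`, `q` satisfy `(q p⁻¹)² = 1` lead to the same level. -/
theorem pos_eq_of_label_sq {d : graph.Dart → diestelLeader}
    (hd : IsCayleyDiagram diestelLeader graph d) {x u v : Lamplighter} (hu : graph.Adj x u)
    (hv : graph.Adj x v) (hne : (d ⟨(x, u), hu⟩ : Lamplighter) ≠ d ⟨(x, v), hv⟩)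
    (hsq : ((d ⟨(x, v), hv⟩ : Lamplighter) * (d ⟨(x, u), hu⟩ : Lamplighter)⁻¹) ^ 2 = 1) :
    u.pos = v.pos := by
  obtain ⟨z, hz, hzl⟩ := exists_adj_label hd u
    (inv_mem_diestelLeader (d ⟨(x, v), hv⟩).2)
  obtain ⟨z', hz', hzl'⟩ := exists_adj_label hd v
    (inv_mem_diestelLeader (d ⟨(x, u), hu⟩).2)
  have hzz : z = z' := by
    -- With `p`, `q` the labels towards `u`, `v`, the walk `z, u, x, v, z'` reads `q p⁻¹ q p⁻¹ = 1`,
    -- so it closes up to a 4-cycle.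
    refine (hd.closed_iff z z' (.cons hz.symm (.cons hu.symm (.cons hv (.cons hz' .nil))))).1 ?_
    simp only [SimpleGraph.Walk.darts_cons, SimpleGraph.Walk.darts_nil, List.map_cons,
      List.map_nil, List.prod_cons, List.prod_nil, mul_one]
    rw [label_symm hd hz, hzl, hzl', label_symm hd hu, inv_inv, ← hsq, sq, mul_assoc]
  subst hzz
  refine pos_eq_of_common_neighbors (x := x) (z := z) ?_ hu hv hz.symm hz'.symm
  rintro rfl
  rw [label_symm hd hu, inv_inj] at hzl
  exact hne hzl

/-- The two generators of position `1` lead to one level and the two of position `-1` to one level.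
These levels differ, as three distinct neighbours cannot share a side. The sign `c` records whether
label `(1, ∅)` goes up. -/
theorem exists_sign_at {d : graph.Dart → diestelLeader}
    (hd : IsCayleyDiagram diestelLeader graph d) (x : Lamplighter) :
    ∃ c : ℤ, c * c = 1 ∧ ∀ (y : Lamplighter) (h : graph.Adj x y),
      (d ⟨(x, y), h⟩ : Lamplighter).pos = c * (y.pos - x.pos) := by
  obtain ⟨a, ha, hal⟩ := exists_adj_label hd x (γ := ⟨1, ∅⟩) (by simp [diestelLeader])
  obtain ⟨b, hb, hbl⟩ := exists_adj_label hd x (γ := ⟨1, {0}⟩) (by simp [diestelLeader])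
  obtain ⟨a', ha', hal'⟩ := exists_adj_label hd x (γ := ⟨-1, ∅⟩) (by simp [diestelLeader])
  obtain ⟨b', hb', hbl'⟩ := exists_adj_label hd x (γ := ⟨-1, {-1}⟩) (by simp [diestelLeader])
  have hab : a.pos = b.pos := by
    apply pos_eq_of_label_sq hd ha hb
    · rw [hal, hbl]; simp
    · rw [hal, hbl]; exact Lamplighter.ext rfl rfl
  have hab' : a'.pos = b'.pos := by
    apply pos_eq_of_label_sq hd ha' hb'
    · rw [hal', hbl']; simp
    · rw [hal', hbl']; exact Lamplighter.ext rfl rfl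
  have hopp : a.pos ≠ a'.pos := by
    intro h
    rcases eq_of_adj_of_pos_eq ha hb ha' hab h with rfl | rfl | rfl
    · rw [hal] at hbl; simp at hbl
    · rw [hal] at hal'; simp at hal'
    · rw [hbl] at hal'; simp at hal'
  have h1 := pos_eq_of_adj ha
  have h2 := pos_eq_of_adj ha'
  have hc : (a.pos - x.pos = 1 ∧ a'.pos - x.pos = -1) ∨
      (a.pos - x.pos = -1 ∧ a'.pos - x.pos = 1) := by omega
  refine ⟨a.pos - x.pos, ?_, fun y h => ?_⟩
  · rcases hc with hc | hc <;> simp [hc.1]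
  · have hm := (d ⟨(x, y), h⟩).2
    simp only [diestelLeader, mem_insert_iff, mem_singleton_iff] at hm
    rcases hm with hm | hm | hm | hm <;> rw [hm]
    · obtain rfl := eq_of_label_eq hd h ha' (hm.trans hal'.symm)
      rcases hc with hc | hc <;> simp [hc.1, hc.2]
    · obtain rfl := eq_of_label_eq hd h ha (hm.trans hal.symm)
      rcases hc with hc | hc <;> simp [hc.1]
    · obtain rfl := eq_of_label_eq hd h hb (hm.trans hbl.symm)
      rw [← hab]
      rcases hc with hc | hc <;> simp [hc.1]
    · obtain rfl := eq_of_label_eq hd h hb' (hm.trans hbl'.symm)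
      rw [← hab']
      rcases hc with hc | hc <;> simp [hc.1, hc.2]

/-- The labellings whose labels move up or down as their edges do, up to the sign `c`. -/
def signed (c : ℤ) : Set (graph.Dart → diestelLeader) :=
  {d | ∀ e, (d e : Lamplighter).pos = c * (e.snd.pos - e.fst.pos)}

theorem mem_signed_of_isCayleyDiagram {d : graph.Dart → diestelLeader}
    (hd : IsCayleyDiagram diestelLeader graph d) : d ∈ signed 1 ∨ d ∈ signed (-1) := by
  obtain ⟨c, hc, h1⟩ := exists_sign_at hd 1
  have h : ∀ x y (h : graph.Adj x y),
      (d ⟨(x, y), h⟩ : Lamplighter).pos = c * (y.pos - x.pos) := by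
    refine induction_on_adj h1 fun x y hxy hx z hz => ?_
    obtain ⟨c', hc', hy⟩ := exists_sign_at hd y
    have e1 := hx y hxy
    have e2 := hy x hxy.symm
    rw [label_symm hd hxy, pos_inv, e1] at e2
    -- The edge between `x` and `y`, read from both ends, carries inverse labels, which forces the
    -- two local signs to agree.
    obtain rfl : c = c' := by
      rcases pos_eq_of_adj hxy with h | h <;> rw [h] at e2 <;> linarith
    exact hy z hz
  rcases mul_self_eq_one_iff.1 hc with rfl | rfl
  · exact .inl fun e => h _ _ e.adj
  · exact .inr fun e => h _ _ e.adj

/-! ### Automorphisms -/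

/-- The diagram obtained by transporting the labels of the Cayley graph along `f`. -/
def transported (f : graph ≃g graph) (e : graph.Dart) : diestelLeader :=
  ⟨(f.symm e.fst)⁻¹ * f.symm e.snd, adj_iff_mem.1 (f.symm.map_adj_iff.2 e.adj)⟩

theorem isCayleyDiagram_transported (f : graph ≃g graph) :
    IsCayleyDiagram diestelLeader graph (transported f) where
  atMostOne := by
    rintro ⟨⟨x, y⟩, h⟩ ⟨⟨x', y'⟩, h'⟩ hfst hl
    obtain rfl : x = x' := hfst
    have := congrArg Subtype.val hl
    simpa [transported] using this
  atLeastOne x γ := by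
    refine ⟨⟨(x, f (f.symm x * γ)), ?_⟩, rfl, ?_⟩
    · rw [← f.symm.map_adj_iff, adj_iff_mem]
      simp
    · simp [transported]
  closed_iff x y p := by
    -- The labels telescope along a walk.
    have h : (p.darts.map fun e => (transported f e : Lamplighter)).prod =
        (f.symm x)⁻¹ * f.symm y := by
      induction p with
      | nil => simp
      | cons h p ih =>
        rw [SimpleGraph.Walk.darts_cons, List.map_cons, List.prod_cons, ih]
        simp [transported, mul_assoc]
    rw [h, inv_mul_eq_one]
    exact f.symm.injective.eq_iff

/-- An automorphism preserves the differences of levels up to a global sign. -/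
theorem exists_sign (f : graph ≃g graph) :
    ∃ c : ℤ, (c = 1 ∨ c = -1) ∧ ∀ x y, (f y).pos - (f x).pos = c * (y.pos - x.pos) := by
  -- With `f.symm`, the label of an edge from `x` to `y` is `(f x)⁻¹ * f y`, whose position is the
  -- difference of the levels of the images.
  obtain ⟨c, hc, h⟩ : ∃ c : ℤ, (c = 1 ∨ c = -1) ∧ transported f.symm ∈ signed c := by
    rcases mem_signed_of_isCayleyDiagram (isCayleyDiagram_transported f.symm) with h | h
    · exact ⟨1, .inl rfl, h⟩
    · exact ⟨-1, .inr rfl, h⟩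
  refine ⟨c, hc, ?_⟩
  have h1 : ∀ y, (f y).pos - (f 1).pos = c * y.pos := by
    refine induction_on_adj (by simp [pos_one]) fun x y hxy hx => ?_
    have := h ⟨(x, y), hxy⟩
    change -(f x).pos + (f y).pos = c * (y.pos - x.pos) at this
    linarith
  intro x y
  linarith [h1 x, h1 y]

theorem mem_orderPreserving_iff_of_sign {f : graph ≃g graph} {c : ℤ} (hc : c = 1 ∨ c = -1)
    (h : ∀ x y, (f y).pos - (f x).pos = c * (y.pos - x.pos)) :
    f ∈ orderPreserving ↔ c = 1 := by
  constructor
  · intro hf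
    have h1 := (hf 1 ⟨1, ∅⟩).2 (by simp [pos_one])
    have h2 := h 1 ⟨1, ∅⟩
    simp only [pos_one] at h2
    omega
  · rintro rfl x y
    have := h x y
    omega

/-- The reflection `(n, A) ↦ (-n, -1 - A)`. -/
def reflection : graph ≃g graph where
  -- The step between levels `n` and `n + 1` switches lamp `n`. Its mirror image lies between `-n -
  -- 1` and `-n` and switches lamp `-1 - n`, hence the offset.
  toFun x := ⟨-x.pos, x.lamps.map (Equiv.subLeft (-1)).toEmbedding⟩
  invFun x := ⟨-x.pos, x.lamps.map (Equiv.subLeft (-1)).toEmbedding⟩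
  left_inv x := by ext k <;> simp
  right_inv x := by ext k <;> simp
  map_rel_iff' := by
    have mem : ∀ (A : Finset ℤ) (k : ℤ),
        k ∈ A.map (Equiv.subLeft (-1)).toEmbedding ↔ -1 - k ∈ A := by
      intro A k
      rw [Finset.mem_map_equiv, Equiv.subLeft_symm_apply]
      ring_nf
    have key : ∀ x y : Lamplighter,
        UpStep ⟨-x.pos, x.lamps.map (Equiv.subLeft (-1)).toEmbedding⟩
          ⟨-y.pos, y.lamps.map (Equiv.subLeft (-1)).toEmbedding⟩ ↔ UpStep y x := by
      intro x y
      simp only [UpStep, mem]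
      constructor
      · rintro ⟨h, h'⟩
        refine ⟨by omega, fun k hk => ?_⟩
        have := h' (-1 - k) (by omega)
        rw [sub_sub_cancel] at this
        exact this.symm
      · rintro ⟨h, h'⟩
        exact ⟨by omega, fun k hk => (h' (-1 - k) (by omega)).symm⟩
    intro x y
    simp only [Equiv.coe_fn_mk, adj_iff, key]
    exact or_comm

theorem pos_reflection (x : Lamplighter) : (reflection x).pos = -x.pos := rfl

theorem reflection_one : reflection 1 = 1 := rfl

/-- The order-preserving rotations form a subgroup of index two. -/
theorem index_orderPreserving :
    (orderPreserving.subgroupOf (rotations diestelLeader)).index = 2 := by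
  have hrefl : ∀ x y, (reflection y).pos - (reflection x).pos = -1 * (y.pos - x.pos) := by
    intro x y
    rw [pos_reflection, pos_reflection]; ring
  refine Subgroup.relIndex_eq_two_iff_exists_notMem_and.2
    ⟨reflection, reflection_one, fun h => ?_, fun f _ => ?_⟩
  · have := (mem_orderPreserving_iff_of_sign (.inr rfl) hrefl).1 h
    omega
  · obtain ⟨c, hc, h⟩ := exists_sign f
    rcases hc with rfl | rfl
    · exact .inr ((mem_orderPreserving_iff_of_sign (.inl rfl) h).2 rfl)
    -- Signs multiply under composition, so composing with `reflection` repairs the sign `-1`.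
    · refine .inl ((mem_orderPreserving_iff_of_sign (c := 1) (.inl rfl) fun x y => ?_).2 rfl)
      change (f (reflection y)).pos - (f (reflection x)).pos = _
      rw [h, hrefl]; ring

/-! ### Non-ergodicity -/

instance countable : Countable Lamplighter :=
  Function.Injective.countable (f := fun x : Lamplighter => (x.pos, x.lamps)) fun _ _ h =>
    Lamplighter.ext (congrArg Prod.fst h) (congrArg Prod.snd h)

instance countable_dart : Countable graph.Dart :=
  Function.Injective.countable (f := fun e : graph.Dart => e.toProd)
    SimpleGraph.Dart.toProd_injective

theorem measurableSet_signed (c : ℤ) : MeasurableSet (signed c) := by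
  have : signed c = ⋂ e : graph.Dart,
      (fun d : graph.Dart → diestelLeader => (d e : Lamplighter)) ⁻¹'
        {γ | γ.pos = c * (e.snd.pos - e.fst.pos)} := by
    ext d; simp [signed]
  rw [this]
  exact .iInter fun e => (measurable_subtype_coe.comp (measurable_pi_apply e))
    MeasurableSpace.measurableSet_top

/-- Automorphisms act on the signs of diagrams by multiplication: translations, of sign 1, fix both
events, and `reflection` exchanges them. -/
theorem preimage_shiftEdge_signed {f : graph ≃g graph} {c : ℤ}
    (h : ∀ x y, (f y).pos - (f x).pos = c * (y.pos - x.pos)) (c' : ℤ) :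
    shiftEdge f ⁻¹' signed c' = signed (c' * c) := by
  ext d
  constructor
  · rintro hd ⟨⟨x, y⟩, hxy⟩
    have := hd ⟨(f x, f y), f.map_adj_iff.2 hxy⟩
    simp only [shiftEdge, h] at this
    rw [mul_assoc, ← this]
    congr 3
    ext <;> simp
  · rintro hd ⟨⟨x, y⟩, hxy⟩
    refine (hd _).trans ?_
    have := h (f.symm x) (f.symm y)
    simp only [RelIso.apply_symm_apply] at this
    change c' * c * ((f.symm y).pos - (f.symm x).pos) = c' * (y.pos - x.pos)
    rw [mul_assoc, ← this]

theorem translation_apply (g x : Lamplighter) : translation diestelLeader g x = g * x := rfl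

theorem preimage_translation_signed (g : Lamplighter) (c : ℤ) :
    shiftEdge (translation diestelLeader g) ⁻¹' signed c = signed c := by
  rw [preimage_shiftEdge_signed (c := 1), mul_one]
  intro x y
  simp only [translation_apply, pos_mul]
  ring

theorem disjoint_signed : Disjoint (signed 1) (signed (-1)) := by
  rw [Set.disjoint_left]
  intro d h h'
  have hadj : graph.Adj 1 ⟨1, ∅⟩ := adj_iff_mem.2 (by simp [diestelLeader])
  have h1 := h ⟨(1, ⟨1, ∅⟩), hadj⟩
  have h2 := h' ⟨(1, ⟨1, ∅⟩), hadj⟩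
  simp only [pos_one] at h1 h2
  omega

/-- An invariant measure on Cayley diagrams gives mass `1 / 2` to each of the two signs. -/
theorem measure_signed_pos_and_lt_one (μ : Measure (graph.Dart → diestelLeader))
    [IsProbabilityMeasure μ] (hμ : ∀ᵐ d ∂μ, IsCayleyDiagram diestelLeader graph d)
    (hinv : μ.map (shiftEdge reflection) = μ) : 0 < μ (signed 1) ∧ μ (signed 1) < 1 := by
  have heq : μ (signed (-1)) = μ (signed 1) := by
    conv_rhs => rw [← hinv, Measure.map_apply (measurable_shiftEdge _) (measurableSet_signed 1),
      preimage_shiftEdge_signed (c := -1) (by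
        intro x y
        rw [pos_reflection, pos_reflection]; ring), one_mul]
  have hsum : μ (signed 1) + μ (signed 1) = 1 := by
    nth_rw 2 [← heq]
    rw [← measure_union disjoint_signed (measurableSet_signed _)]
    refine (prob_compl_eq_zero_iff ((measurableSet_signed _).union (measurableSet_signed _))).1 ?_
    exact hμ.mono fun d hd => mem_signed_of_isCayleyDiagram hd
  constructor
  · refine pos_iff_ne_zero.2 fun h => ?_
    rw [h] at hsum; simp at hsum
  · refine lt_of_le_of_ne prob_le_one fun h => ?_
    rw [h, one_add_one_eq_two] at hsum
    exact absurd hsum (by norm_num)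

theorem exists_translation_notMem (s : Finset Lamplighter) :
    ∃ g : Lamplighter, ∀ x ∈ s, translation diestelLeader g x ∉ s := by
  obtain ⟨M, hM⟩ := (s.image pos).bddAbove
  obtain ⟨m, hm⟩ := (s.image pos).bddBelow
  -- A shift by more than the spread of the levels occurring in `s`.
  refine ⟨⟨M - m + 1, ∅⟩, fun x hx hx' => ?_⟩
  have h1 := hm (Finset.mem_coe.2 (Finset.mem_image_of_mem pos hx))
  have h2 := hM (Finset.mem_coe.2 (Finset.mem_image_of_mem pos hx'))
  simp only [translation_apply, pos_mul] at h2
  omega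

/-- Invariance under `reflection` puts the mass of `signed 1` strictly between 0 and 1, while
ergodicity under translations makes it 0 or 1. -/
theorem not_admitsAutFIIDCayleyDiagram : ¬ AdmitsAutFIIDCayleyDiagram diestelLeader := by
  rintro ⟨μ, hμ, hd⟩
  have := hμ.isProbabilityMeasure
  obtain ⟨h0, h1⟩ := measure_signed_pos_and_lt_one μ hd (hμ.map_shiftEdge reflection)
  rcases hμ.eq_zero_or_one (range (translation diestelLeader))
    (fun s => by simpa using exists_translation_notMem s) (measurableSet_signed 1)
    (by rintro _ ⟨g, rfl⟩; exact preimage_translation_signed g 1) with h | h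
  · exact h0.ne' h
  · exact h1.ne h

end Lamplighter

end FIIDCayley

theorem mainTheorem8 :
    -- the order-preserving elements of `Aut_e(G)` form a subgroup of index `2`
    (FIIDCayley.Lamplighter.orderPreserving.subgroupOf
        (FIIDCayley.rotations FIIDCayley.Lamplighter.diestelLeader)).index = 2 ∧
    -- no `Aut(G)`-invariant probability measure on Cayley diagrams is ergodic under `L`
    (∀ μ : MeasureTheory.Measure
          (FIIDCayley.Lamplighter.graph.Dart → FIIDCayley.Lamplighter.diestelLeader),
        MeasureTheory.IsProbabilityMeasure μ →
        (∀ᵐ d ∂μ, FIIDCayley.IsCayleyDiagram FIIDCayley.Lamplighter.diestelLeader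
          FIIDCayley.Lamplighter.graph d) →
        (∀ f : FIIDCayley.Lamplighter.graph ≃g FIIDCayley.Lamplighter.graph,
          μ.map (FIIDCayley.shiftEdge f) = μ) →
        ∃ S : Set (FIIDCayley.Lamplighter.graph.Dart → FIIDCayley.Lamplighter.diestelLeader),
          MeasurableSet S ∧
          (∀ g : FIIDCayley.Lamplighter,
            FIIDCayley.shiftEdge
              (FIIDCayley.translation FIIDCayley.Lamplighter.diestelLeader g) ⁻¹' S = S) ∧
          0 < μ S ∧ μ S < 1) ∧
    -- `G` admits no `Aut(G)`-f.i.i.d. Cayley diagram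
    ¬ FIIDCayley.AdmitsAutFIIDCayleyDiagram FIIDCayley.Lamplighter.diestelLeader :=
  ⟨FIIDCayley.Lamplighter.index_orderPreserving,
    fun μ _ hμ hinv => ⟨FIIDCayley.Lamplighter.signed 1,
      FIIDCayley.Lamplighter.measurableSet_signed 1,
      fun g => FIIDCayley.Lamplighter.preimage_translation_signed g 1,
      FIIDCayley.Lamplighter.measure_signed_pos_and_lt_one μ hμ (hinv _)⟩,
    FIIDCayley.Lamplighter.not_admitsAutFIIDCayleyDiagram⟩
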